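/- Let $(\Omega,\mathcal F,\mathbb P,\theta)$ be a stationary ergodic quadruple: $(\Omega,\mathcal F,\mathbb P)$ is a probability space and $\theta$ is a bi-measurable bijection of $\Omega$ that preserves $\mathbb P$ and is ergodic. Let $\sigma\ge 0$ and $\tau>0$ (almost surely) be integrable random variables; for $n\in\mathbb Z$, $\sigma\circ\theta^n$ is the service time of customer $C_n$ and $\tau\circ\theta^n$ is the time between the arrivals of $C_n$ and $C_{n+1}$. Let $S$ and $p$ be integers with $1\le p<S$. Consider $S$ parallel first-in-first-out queues under the J$_{p+1}$SW policy: an arriving customer joins a free server if there is one, and otherwise the server with the $(p+1)$-th smallest workload. Let $\overline{(\mathbb R_+)^S}$ be the set of vectors $u=(u(1),\dots,u(S))$ of non-negative reals with $u(1)\le\dots\le u(S)$. The vector of workloads found by the arriving customers, sorted in ascending order, is then driven by the random map $$G^p:\overline{(\mathbb R_+)^S}\to\overline{(\mathbb R_+)^S},\qquad G^p(u)=\begin{cases}\overline{[u+\sigma\mathbf e_1-\tau\mathbf 1]^+}&\text{if }u(1)=0,\\[2pt] \overline{[u+\sigma\mathbf e_{p+1}-\tau\mathbf 1]^+}&\text{if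 }u(1)>0,\end{cases}$$ where $\mathbf e_i$ is the $i$-th unit vector, $\mathbf 1=(1,\dots,1)$, $[\cdot]^+$ is the coordinatewise positive part, and $\overline{v}$ is the vector $v$ sorted in ascending order. For $\ell\ge 1$ put $$Z_\ell=\Bigl[\sup_{k\ge\ell}\Bigl(\sigma\circ\theta^{-k}-\sum_{i=1}^k\tau\circ\theta^{-i}\Bigr)\Bigr]^+ .$$ Assume that the input is GI/GI, i.e. $(\sigma\circ\theta^n)_{n\in\mathbb Z}$ and $(\tau\circ\theta^n)_{n\in\mathbb Z}$ are mutually independent i.i.d. sequences, and that the distribution of $\tau$ has unbounded support, i.e. $\mathbb P(\tau>M)>0$ for every real $M$. If $$\mathbb E[\sigma]\,\mathbb P(Z_p>0)<(S-p)\,\mathbb E[\tau]\qquad\text{and}\qquad \mathbb P(Z_p=0)>0,$$ then the equation $$W\circ\theta=G^p(W)\quad\mathbb P\text{-a.s.}$$ has a proper solution, i.e. there is a random variable $W:\Omega\to\overline{(\mathbb R_+)^S}$ (with finite coordinates) that satisfies it. -/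

import Mathlib

open MeasureTheory ProbabilityTheory

/-- Service profiles of a system of `S` servers: vectors of `S` non-negative reals (finite
workloads) sorted in ascending order. They carry the Borel structure induced by `ℝ^S`. -/
abbrev ServiceProfile (S : ℕ) : Type :=
  {u : Fin S → ℝ // Monotone u ∧ ∀ i, 0 ≤ u i}

/-- The fully ordered version (ascending order) of the positive part of a vector. -/
noncomputable def orderedPosPart {S : ℕ} (v : Fin S → ℝ) : ServiceProfile S :=
  ⟨(fun i => max (v i) 0) ∘ Tuple.sort (fun i => max (v i) 0),
    Tuple.monotone_sort _, fun _ => le_max_right _ _⟩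

/-- A customer with service time `s` is assigned to the server having the workload of rank `j`
(ranks are counted from `0`), then a time `t` elapses: the ordered version of
`[u + s e_j - t 1]^+`. -/
noncomputable def assignTo {S : ℕ} (j : Fin S) (s t : ℝ) (u : ServiceProfile S) :
    ServiceProfile S :=
  orderedPosPart fun i => u.1 i + (if i = j then s else 0) - t

/-- The driving map of the policy "join a free server if there is one, otherwise join the
server having the `(p+1)`-th smallest workload": the service profile seen by the next customer,
if the present customer sees `u`, has service time `s` and arrives a time `t` before the next
one. -/
noncomputable def jswMap {S : ℕ} (p : ℕ) (hp : p < S) (s t : ℝ) (u : ServiceProfile S) :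
    ServiceProfile S :=
  open Classical in
  if u.1 ⟨0, Nat.zero_lt_of_lt hp⟩ = 0 then assignTo ⟨0, Nat.zero_lt_of_lt hp⟩ s t u
  else assignTo ⟨p, hp⟩ s t u

section Input

variable {Ω : Type*} [MeasurableSpace Ω]

/-- The iterate `θ^n`, `n ∈ ℤ`, of a bi-measurable bijection `θ`. -/
def shift (θ : Ω ≃ᵐ Ω) (n : ℤ) : Ω → Ω := ⇑((θ.toEquiv : Equiv.Perm Ω) ^ n)

/-- GI/GI input: the service times `σ ∘ θ^n` and the inter-arrival times `τ ∘ θ^n`, `n ∈ ℤ`, are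
two mutually independent sequences, each of them independent and identically distributed. -/
structure IsGIGI (P : Measure Ω) (θ : Ω ≃ᵐ Ω) (σ τ : Ω → ℝ) : Prop where
  indep_service : iIndepFun (fun (n : ℤ) ω => σ (shift θ n ω)) P
  ident_service : ∀ n : ℤ, IdentDistrib (fun ω => σ (shift θ n ω)) σ P P
  indep_interarrival : iIndepFun (fun (n : ℤ) ω => τ (shift θ n ω)) P
  ident_interarrival : ∀ n : ℤ, IdentDistrib (fun ω => τ (shift θ n ω)) τ P P
  indep_sequences : IndepFun (fun ω (n : ℤ) => σ (shift θ n ω))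
    (fun ω (n : ℤ) => τ (shift θ n ω)) P

/-- `Z_ℓ = [sup_{k ≥ ℓ} (σ ∘ θ^{-k} - ∑_{i=1}^k τ ∘ θ^{-i})]^+`, with values in the extended
reals. -/
noncomputable def residualSup (θ : Ω ≃ᵐ Ω) (σ τ : Ω → ℝ) (l : ℕ) (ω : Ω) : EReal :=
  max (⨆ (k : ℕ) (_ : l ≤ k),
    ((σ (shift θ (-(k : ℤ)) ω) -
      ∑ i ∈ Finset.Icc 1 k, τ (shift θ (-(i : ℤ)) ω) : ℝ) : EReal)) 0

end Input

/-! Start the system empty at time `-n` and look at it at time `0`. Since `G^p` is not monotone,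
Loynes' increasing scheme is applied to a majorant of the `S - p` largest workloads instead.

If an arrival finds no free server, even the least loaded server holds a customer who came at least
`p` arrivals ago, so `Z_p > 0`. Hence the majorant gives the job to its least loaded server on `{Z_p
> 0}` and to a free one elsewhere. It dominates the queue (`queueState_le_tailState`) and increases
with `n`. Were its smallest coordinate to diverge, its total would have asymptotic mean increment
`E[σ; Z_p > 0] - (S - p) E[τ]`. Independence of `σ` from the past turns this into the assumed
negative quantity, while monotonicity forces mean increments to be non-negative. The larger
coordinates follow in the same way (`ae_bddAbove_tailState`).

So the workloads are bounded uniformly in `n`. As `τ` is unbounded and independent of the past, with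
positive probability one inter-arrival time empties all these systems at once. By ergodicity this
happens at some past time almost surely, after which the systems started earlier coincide; their
common value is `W`. -/

/-! ### Order statistics. -/

/-- Counting replaces any handling of the sorting permutation: all bounds on ranked workloads below
come from a suitable choice of `s`. -/
theorem orderedPosPart_le {S : ℕ} {v : Fin S → ℝ} {c : ℝ} {i : Fin S} (s : Finset (Fin S))
    (hs : (i : ℕ) < s.card) (h : ∀ j ∈ s, max (v j) 0 ≤ c) : (orderedPosPart v).1 i ≤ c := by
  set f : Fin S → ℝ := fun i => max (v i) 0 with hf
  refine (Tuple.lt_card_le_iff_apply_le_of_monotone (Tuple.monotone_sort f)).1 (hs.trans_le ?_)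
  rw [← Finset.card_map (Tuple.sort f).symm.toEmbedding]
  refine Finset.card_le_card fun j hj => ?_
  obtain ⟨k, hk, rfl⟩ := Finset.mem_map.1 hj
  simpa [hf] using h k hk

theorem measurable_orderedPosPart {S : ℕ} :
    Measurable (orderedPosPart : (Fin S → ℝ) → ServiceProfile S) := by
  refine Measurable.subtype_mk (measurable_pi_lambda _ fun i => measurable_of_Iic fun c => ?_)
  have h : (fun v : Fin S → ℝ => ((fun i => max (v i) 0) ∘
      Tuple.sort (fun i => max (v i) 0)) i) ⁻¹' Set.Iic c =
      ⋃ s ∈ {s : Finset (Fin S) | (i : ℕ) < s.card}, ⋂ j ∈ s, {v | max (v j) 0 ≤ c} := by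
    ext v
    simp only [Set.mem_preimage, Set.mem_Iic, Set.mem_ofPred_eq, Set.mem_iUnion, Set.mem_iInter,
      exists_prop]
    constructor
    · intro hv
      refine ⟨(Finset.Iic i).map (Tuple.sort fun i => max (v i) 0).toEmbedding, by simp, ?_⟩
      intro j hj
      obtain ⟨k, hk, rfl⟩ := Finset.mem_map.1 hj
      exact (Tuple.monotone_sort (fun i => max (v i) 0) (Finset.mem_Iic.1 hk)).trans hv
    · rintro ⟨s, hs, h⟩
      exact orderedPosPart_le s hs h
  rw [h]
  refine MeasurableSet.biUnion (Set.to_countable _) fun s _ =>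
    MeasurableSet.biInter (Set.to_countable _) fun j _ => ?_
  exact measurableSet_le ((measurable_pi_apply j).max measurable_const) measurable_const

/-! ### Rank-by-rank bounds for one arrival. -/

section Assign

variable {S : ℕ} {s t : ℝ} {u : ServiceProfile S}

/-- The workload of rank `l` after an assignment is at most the previous one of rank `l + 1`. -/
theorem assignTo_le_next (j l l' : Fin S) (h : (l : ℕ) + 1 = l') :
    (assignTo j s t u).1 l ≤ max (u.1 l' - t) 0 := by
  by_cases hj : j ≤ l'
  -- Dropping the server that receives the job from the `l + 2` lowest ones still leaves `l + 1`.
  · refine orderedPosPart_le ((Finset.Iic l').erase j) ?_ fun m hm => ?_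
    · rw [Finset.card_erase_of_mem (Finset.mem_Iic.2 hj), Fin.card_Iic]; omega
    · have hm' := Finset.mem_erase.1 hm
      have := u.2.1 (Finset.mem_Iic.1 hm'.2)
      rw [if_neg hm'.1]
      exact max_le_max (by linarith) le_rfl
  · refine orderedPosPart_le (Finset.Iic l') ?_ fun m hm => ?_
    · rw [Fin.card_Iic]; omega
    · have hm' := Finset.mem_Iic.1 hm
      have := u.2.1 hm'
      rw [if_neg (by rintro rfl; exact hj hm')]
      exact max_le_max (by linarith) le_rfl

theorem assignTo_le_max (j l : Fin S) :
    (assignTo j s t u).1 l ≤ max (max (u.1 l) (u.1 j + s) - t) 0 := by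
  refine orderedPosPart_le (Finset.Iic l) (by simp) fun m hm => max_le_max ?_ le_rfl
  have := u.2.1 (Finset.mem_Iic.1 hm)
  split_ifs with h
  · subst h; linarith [le_max_right (u.1 l) (u.1 m + s)]
  · linarith [le_max_left (u.1 l) (u.1 j + s)]

theorem assignTo_le_of_lt {j l : Fin S} (h : l < j) :
    (assignTo j s t u).1 l ≤ max (u.1 l - t) 0 := by
  refine orderedPosPart_le (Finset.Iic l) (by simp) fun m hm => max_le_max ?_ le_rfl
  have := u.2.1 (Finset.mem_Iic.1 hm)
  rw [if_neg (((Finset.mem_Iic.1 hm).trans_lt h).ne)]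
  linarith

/-- The empty system. -/
def emptyProfile (S : ℕ) : ServiceProfile S := ⟨fun _ => 0, monotone_const, fun _ => le_rfl⟩

theorem assignTo_eq_empty (hs : 0 ≤ s) (j : Fin S) (h : ∀ i, u.1 i + s ≤ t) :
    assignTo j s t u = emptyProfile S := by
  refine Subtype.ext (funext fun i => le_antisymm ?_ ((assignTo j s t u).2.2 i))
  refine orderedPosPart_le Finset.univ (by simp) fun m _ => max_le ?_ le_rfl
  have := h m
  change _ ≤ (0 : ℝ)
  split_ifs <;> linarith

variable {p : ℕ} (hp : p < S)

theorem jswMap_eq_empty (hs : 0 ≤ s) (h : ∀ i, u.1 i + s ≤ t) :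
    jswMap p hp s t u = emptyProfile S := by
  unfold jswMap
  split_ifs <;> exact assignTo_eq_empty hs _ h

theorem jswMap_le_next (l l' : Fin S) (h : (l : ℕ) + 1 = l') :
    (jswMap p hp s t u).1 l ≤ max (u.1 l' - t) 0 := by
  unfold jswMap
  split_ifs <;> exact assignTo_le_next _ l l' h

theorem jswMap_le_of_lt (l : Fin S) (h : (l : ℕ) < p) :
    (jswMap p hp s t u).1 l ≤ max (max (u.1 l) s - t) 0 := by
  unfold jswMap
  split_ifs with h0
  · refine (assignTo_le_max _ l).trans_eq ?_
    rw [h0, zero_add]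
  · refine (assignTo_le_of_lt (show l < ⟨p, hp⟩ from h)).trans (max_le_max ?_ le_rfl)
    linarith [le_max_left (u.1 l) s]

theorem jswMap_le_max_of_free (l : Fin S) (h0 : u.1 ⟨0, Nat.zero_lt_of_lt hp⟩ = 0) :
    (jswMap p hp s t u).1 l ≤ max (max (u.1 l) s - t) 0 := by
  unfold jswMap
  rw [if_pos h0]
  refine (assignTo_le_max _ l).trans_eq ?_
  rw [h0, zero_add]

theorem jswMap_le_max (l : Fin S) :
    (jswMap p hp s t u).1 l ≤ max (max (u.1 l) (u.1 ⟨p, hp⟩ + s) - t) 0 := by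
  by_cases h0 : u.1 ⟨0, Nat.zero_lt_of_lt hp⟩ = 0
  · refine (jswMap_le_max_of_free hp l h0).trans (max_le_max (sub_le_sub_right
      (max_le_max le_rfl ?_) _) le_rfl)
    linarith [u.2.2 ⟨p, hp⟩]
  · unfold jswMap
    rw [if_neg h0]
    exact assignTo_le_max _ l

end Assign

theorem measurable_jswMap {S p : ℕ} (hp : p < S) :
    Measurable fun x : ℝ × ℝ × ServiceProfile S => jswMap p hp x.1 x.2.1 x.2.2 := by
  have hu : ∀ i : Fin S, Measurable fun x : ℝ × ℝ × ServiceProfile S => x.2.2.1 i := fun i =>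
    (measurable_pi_apply i).comp (measurable_subtype_coe.comp measurable_snd.snd)
  have ha : ∀ j : Fin S, Measurable fun x : ℝ × ℝ × ServiceProfile S =>
      assignTo j x.1 x.2.1 x.2.2 := fun j =>
    measurable_orderedPosPart.comp (measurable_pi_lambda _ fun i =>
      ((hu i).add (by split_ifs <;> fun_prop)).sub measurable_snd.fst)
  unfold jswMap
  exact Measurable.ite (hu _ (measurableSet_singleton 0)) (ha _) (ha _)

/-! ### Independence from the past. -/

section Independence

variable {Ω : Type*} [MeasurableSpace Ω] {P : Measure Ω}

theorem ProbabilityTheory.IndepFun.prodMk_of_indepFun [IsProbabilityMeasure P] {α β γ : Type*} [MeasurableSpace α]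
    [MeasurableSpace β] [MeasurableSpace γ] {A : Ω → α} {B : Ω → β} {C : Ω → γ}
    (hA : Measurable A) (hB : Measurable B) (hC : Measurable C)
    (h : IndepFun A (fun ω => (B ω, C ω)) P) (hBC : IndepFun B C P) :
    IndepFun (fun ω => (A ω, B ω)) C P := by
  have hAB : IndepFun A B P := h.comp measurable_id measurable_fst
  have : IsProbabilityMeasure (P.map A) := Measure.isProbabilityMeasure_map hA.aemeasurable
  have : IsProbabilityMeasure (P.map B) := Measure.isProbabilityMeasure_map hB.aemeasurable
  have : IsProbabilityMeasure (P.map C) := Measure.isProbabilityMeasure_map hC.aemeasurable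
  rw [indepFun_iff_map_prod_eq_prod_map_map (by fun_prop) (by fun_prop)] at h hBC hAB ⊢
  rw [hBC] at h
  rw [hAB, ← (measurePreserving_prodAssoc (P.map A) (P.map B) (P.map C)).symm.map_eq, ← h,
    Measure.map_map (by fun_prop) (by fun_prop)]
  rfl

theorem ProbabilityTheory.iIndepFun.indepFun_restrict_compl {ι β : Type*} [MeasurableSpace β]
    {F : ι → Ω → β} (hF : iIndepFun F P) (hm : ∀ i, Measurable (F i)) (s : Set ι) {i : ι}
    (hi : i ∉ s) : IndepFun (fun ω (j : s) => F j ω) (F i) P := by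
  have h := indep_iSup_of_disjoint (fun j => (hm j).comap_le) hF
    (Set.disjoint_singleton_right.2 hi)
  rw [IndepFun_iff_Indep]
  refine indep_of_indep_of_le_left (indep_of_indep_of_le_right h ?_) ?_
  · exact le_iSup₂_of_le i rfl le_rfl
  · refine Measurable.comap_le ?_
    refine @measurable_pi_lambda Ω s _ (⨆ i ∈ s, MeasurableSpace.comap (F i) _) _ _ fun j => ?_
    exact Measurable.mono (comap_measurable (F j))
      (le_iSup₂_of_le (f := fun i (_ : i ∈ s) => MeasurableSpace.comap (F i) _) j.1 j.2 le_rfl)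
      le_rfl

/-- A member of an independent family is independent of the others together with any family
independent of the whole one. -/
theorem ProbabilityTheory.IndepFun.indepFun_prodMk_restrict [IsProbabilityMeasure P] {ι α β : Type*} [MeasurableSpace α]
    [MeasurableSpace β] {G : Ω → α} {F : ι → Ω → β} (hG : Measurable G)
    (hm : ∀ i, Measurable (F i)) (hF : iIndepFun F P)
    (h : IndepFun G (fun ω i => F i ω) P) (s : Set ι) {i : ι} (hi : i ∉ s) :
    IndepFun (fun ω => (G ω, fun j : s => F j ω)) (F i) P := by
  refine IndepFun.prodMk_of_indepFun hG (measurable_pi_lambda _ fun j => hm j) (hm i) ?_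
    (hF.indepFun_restrict_compl hm s hi)
  exact h.comp measurable_id (ψ := fun f : ι → β => ((fun j : s => f j), f i))
    (by fun_prop)

theorem ProbabilityTheory.IndepFun.setIntegral_eq {α : Type*} [mα : MeasurableSpace α]
    {G : Ω → α} {f : Ω → ℝ} (hG : Measurable G) (hf : Measurable f) (h : IndepFun G f P)
    {B : Set Ω} (hB : MeasurableSet[mα.comap G] B) :
    ∫ ω in B, f ω ∂P = (∫ ω, f ω ∂P) * P.real B := by
  obtain ⟨A, hA, rfl⟩ := hB
  have h1 : IndepFun (fun ω => A.indicator (fun _ => (1 : ℝ)) (G ω)) f P :=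
    h.comp (φ := A.indicator fun _ => (1 : ℝ)) (measurable_const.indicator hA) measurable_id
  have h2 := h1.integral_mul_eq_mul_integral
    ((measurable_const.indicator hA).comp hG).aestronglyMeasurable hf.aestronglyMeasurable
  rw [← integral_indicator (hG hA), mul_comm, ← integral_indicator_one (hG hA)]
  convert! h2 using 1
  refine integral_congr_ae (Filter.Eventually.of_forall fun ω => ?_)
  by_cases hω : G ω ∈ A <;> simp [hω]

theorem ProbabilityTheory.IndepFun.measure_inter_eq {α β : Type*} [mα : MeasurableSpace α]
    [MeasurableSpace β] {G : Ω → α} {f : Ω → β} (h : IndepFun G f P)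
    {B : Set Ω} (hB : MeasurableSet[mα.comap G] B) {A : Set β} (hA : MeasurableSet A) :
    P (B ∩ f ⁻¹' A) = P B * P (f ⁻¹' A) := by
  obtain ⟨C, hC, rfl⟩ := hB
  exact h.measure_inter_preimage_eq_mul _ _ hC hA

end Independence

open Filter Topology

/-! ### Backward recursions and coupling. -/

section Backward

variable {Ω α : Type*} [MeasurableSpace Ω]

/-- The state at time `0` of the recursion driven by `f`, started from `a` at time `-n`. -/
def backwardState (θ : Ω ≃ᵐ Ω) (f : Ω → α → α) (a : α) : ℕ → Ω → α
  | 0, _ => a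
  | n + 1, ω => f (θ.symm ω) (backwardState θ f a n (θ.symm ω))

variable {θ : Ω ≃ᵐ Ω} {f : Ω → α → α} {a : α}

theorem backwardState_succ_apply (n : ℕ) (ω : Ω) :
    backwardState θ f a (n + 1) (θ ω) = f ω (backwardState θ f a n ω) := by
  simp [backwardState]

theorem measurable_backwardState [MeasurableSpace α] (hf : Measurable fun x : Ω × α => f x.1 x.2)
    (n : ℕ) : Measurable (backwardState θ f a n) := by
  induction n with
  | zero => exact measurable_const
  | succ n ih =>
    exact hf.comp (θ.symm.measurable.prodMk (ih.comp θ.symm.measurable))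

/-- If at some past time all the backward states coincide with the initial one, then the backward
states at time `0` are eventually constant. -/
theorem eventuallyConst_backwardState (k : ℕ) {ω : Ω}
    (h : ∀ n, backwardState θ f a n ((⇑θ.symm)^[k] ω) = a) (n : ℕ) :
    backwardState θ f a (n + k) ω = backwardState θ f a k ω := by
  induction k generalizing ω with
  | zero => exact h n
  | succ k ih =>
    rw [← add_assoc]
    simp only [backwardState]
    rw [ih h]

end Backward

/-- The points whose backward orbit meets `D` form a set stable under `θ`, hence trivial by
ergodicity; it contains `D`. -/
theorem Ergodic.ae_exists_iterate_symm_mem {Ω : Type*} [MeasurableSpace Ω] {P : Measure Ω}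
    [IsFiniteMeasure P] {θ : Ω ≃ᵐ Ω} (hθ : Ergodic θ P) {D : Set Ω} (hD : MeasurableSet D)
    (hpos : 0 < P D) : ∀ᵐ ω ∂P, ∃ k : ℕ, (⇑θ.symm)^[k] ω ∈ D := by
  set E : Set Ω := {ω | ∃ k : ℕ, (⇑θ.symm)^[k] ω ∈ D}
  have hE : MeasurableSet E := by
    have : E = ⋃ k : ℕ, ((⇑θ.symm)^[k]) ⁻¹' D := by ext; simp [E]
    rw [this]
    exact MeasurableSet.iUnion fun k => (θ.symm.measurable.iterate k) hD
  have hsub : E ⊆ θ ⁻¹' E := by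
    rintro ω ⟨k, hk⟩
    exact ⟨k + 1, by simpa using hk⟩
  rcases hθ.ae_empty_or_univ_of_ae_le_preimage hE.nullMeasurableSet hsub.eventuallyLE with h | h
  · exfalso
    have : P E = 0 := by rw [measure_congr h, measure_empty]
    exact hpos.ne' (measure_mono_null (show D ⊆ E from fun ω hω => ⟨0, hω⟩) this)
  · exact eventuallyEq_univ.1 h

/-! ### One step of the majorant. -/

section Tail

/-- One step of the majorant of the `q` largest workloads, which are listed in ascending order:
a job of size `w` replaces the smallest of them whenever it is larger, then a time `t` elapses. -/
noncomputable def tailStep (q : ℕ) (w t : ℝ) (v : ℕ → ℝ) (i : ℕ) : ℝ :=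
  max ((if i + 1 < q then min (max (v i) w) (v (i + 1)) else max (v i) w) - t) 0

variable {q : ℕ} {w w' t : ℝ} {v v' : ℕ → ℝ}

theorem tailStep_nonneg (i : ℕ) : 0 ≤ tailStep q w t v i := le_max_right _ _

theorem tailStep_mono (hw : w ≤ w') (hv : ∀ i, v i ≤ v' i) (i : ℕ) :
    tailStep q w t v i ≤ tailStep q w' t v' i := by
  unfold tailStep
  refine max_le_max (sub_le_sub_right ?_ _) le_rfl
  split_ifs
  · exact min_le_min (max_le_max (hv i) hw) (hv _)
  · exact max_le_max (hv i) hw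

theorem tailStep_le_succ {i : ℕ} (hi : i + 1 < q) (hv : i + 1 + 1 < q → v (i + 1) ≤ v (i + 1 + 1)) :
    tailStep q w t v i ≤ tailStep q w t v (i + 1) := by
  unfold tailStep
  refine max_le_max (sub_le_sub_right ?_ _) le_rfl
  rw [if_pos hi]
  refine (min_le_right _ _).trans ?_
  split_ifs with h
  · exact le_min (le_max_left _ _) (hv h)
  · exact le_max_left _ _

theorem sub_le_tailStep {i : ℕ} (hv : i + 1 < q → v i ≤ v (i + 1)) :
    v i - t ≤ tailStep q w t v i := by
  unfold tailStep
  refine le_trans (sub_le_sub_right ?_ _) (le_max_left _ _)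
  split_ifs with h
  · exact le_min (le_max_left _ _) (hv h)
  · exact le_max_left _ _

/-- Before service, rank `i` becomes `w` clipped to `[v i, v (i + 1)]`. Its rise is a difference of
positive parts at consecutive ranks, a form chosen to telescope. -/
theorem tailStep_le {i : ℕ} (hv : i + 1 < q → v i ≤ v (i + 1)) :
    tailStep q w t v i ≤ v i + max (w - v i) 0 -
      (if i + 1 < q then max (w - v (i + 1)) 0 else 0) - min (v i) t := by
  unfold tailStep
  set x := if i + 1 < q then min (max (v i) w) (v (i + 1)) else max (v i) w with hx
  have h1 : v i ≤ x := by
    rw [hx]; split_ifs with h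
    · exact le_min (le_max_left _ _) (hv h)
    · exact le_max_left _ _
  have h2 : x ≤ v i + max (w - v i) 0 - (if i + 1 < q then max (w - v (i + 1)) 0 else 0) := by
    rw [hx]; split_ifs with h
    · have := hv h
      rcases le_total w (v i) with h3 | h3 <;> rcases le_total w (v (i + 1)) with h4 | h4 <;>
        simp [h3, h4, this]
      all_goals linarith [min_le_left w (v (i+1)), min_le_right w (v (i+1)), min_le_left (v i) (v (i+1))]
    · rcases le_total w (v i) with h3 | h3 <;> simp [h3]
  refine max_le ?_ ?_
  · linarith [min_le_right (v i) t]
  · linarith [min_le_left (v i) t]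

theorem sum_tailStep_le (hv : ∀ i, i + 1 < q → v i ≤ v (i + 1)) {i : ℕ} (hi : i < q) :
    ∑ l ∈ Finset.Ico i q, tailStep q w t v l ≤
      ∑ l ∈ Finset.Ico i q, v l + max (w - v i) 0 - ∑ l ∈ Finset.Ico i q, min (v l) t := by
  obtain ⟨d, rfl⟩ : ∃ d, q = i + 1 + d := ⟨q - (i + 1), by omega⟩
  -- The value `0` at `q` encodes that the top rank has no upper neighbour, so only the term at `i`
  -- survives telescoping.
  set g : ℕ → ℝ := fun l => if l < i + 1 + d then max (w - v l) 0 else 0 with hg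
  have h : ∀ l ∈ Finset.Ico i (i + 1 + d), tailStep (i + 1 + d) w t v l ≤
      v l - (g (l + 1) - g l) - min (v l) t := by
    intro l hl
    have := tailStep_le (w := w) (t := t) (hv l)
    simp only [hg, if_pos (Finset.mem_Ico.1 hl).2]
    linarith
  refine (Finset.sum_le_sum h).trans_eq ?_
  rw [Finset.sum_sub_distrib, Finset.sum_sub_distrib, Finset.sum_Ico_sub g (by omega)]
  simp [hg, show i < i + 1 + d by omega]

end Tail

/-! ### Stationary majorant: monotonicity, drift and boundedness. -/

section Stationary

variable {Ω : Type*} [MeasurableSpace Ω]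

/-- The stationary driving map of the majorant: the arriving customer is given to the least loaded
of the `q` servers on the event `B`, and otherwise joins a free server. -/
noncomputable def tailMap (q : ℕ) (B : Set Ω) (σ τ : Ω → ℝ) (ω : Ω) (v : ℕ → ℝ) : ℕ → ℝ :=
  tailStep q (σ ω + B.indicator (fun _ => v 0) ω) (τ ω) v

/-- The majorant at time `0`, started empty at time `-n`. -/
noncomputable def tailState (θ : Ω ≃ᵐ Ω) (q : ℕ) (B : Set Ω) (σ τ : Ω → ℝ) (n : ℕ) (ω : Ω) :
    ℕ → ℝ :=
  backwardState θ (tailMap q B σ τ) 0 n ω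

variable {θ : Ω ≃ᵐ Ω} {q : ℕ} {B : Set Ω} {σ τ : Ω → ℝ}

theorem tailState_succ_apply (n : ℕ) (ω : Ω) :
    tailState θ q B σ τ (n + 1) (θ ω) = tailMap q B σ τ ω (tailState θ q B σ τ n ω) :=
  backwardState_succ_apply n ω

theorem tailState_nonneg (n : ℕ) (ω : Ω) (i : ℕ) : 0 ≤ tailState θ q B σ τ n ω i := by
  cases n with
  | zero => exact le_rfl
  | succ n => exact tailStep_nonneg i

theorem tailState_sorted (n : ℕ) (ω : Ω) (i : ℕ) (hi : i + 1 < q) :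
    tailState θ q B σ τ n ω i ≤ tailState θ q B σ τ n ω (i + 1) := by
  induction n generalizing ω i with
  | zero => exact le_rfl
  | succ n ih => exact tailStep_le_succ hi (ih (θ.symm ω) (i + 1))

theorem tailState_sorted_of_le (n : ℕ) (ω : Ω) {i j : ℕ} (hij : i ≤ j) (hj : j < q) :
    tailState θ q B σ τ n ω i ≤ tailState θ q B σ τ n ω j := by
  induction j, hij using Nat.le_induction with
  | base => exact le_rfl
  | succ j _ ih => exact (ih (by omega)).trans (tailState_sorted n ω j hj)

/-- Loynes' argument: an earlier start can only raise the state above the empty one, and the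
monotone step preserves this order. -/
theorem tailState_monotone (ω : Ω) (i : ℕ) : Monotone fun n => tailState θ q B σ τ n ω i := by
  refine monotone_nat_of_le_succ fun n => ?_
  induction n generalizing ω i with
  | zero => exact tailState_nonneg 1 ω i
  | succ n ih =>
    refine tailStep_mono (add_le_add le_rfl ?_) (fun j => ih (θ.symm ω) j) i
    exact Set.indicator_le_indicator (ih (θ.symm ω) 0)

theorem measurable_tailState (hB : MeasurableSet B) (hσ : Measurable σ) (hτ : Measurable τ)
    (n : ℕ) : Measurable (tailState θ q B σ τ n) := by
  refine measurable_backwardState (measurable_pi_lambda _ fun i => ?_) n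
  have hv : ∀ j, Measurable fun x : Ω × (ℕ → ℝ) => x.2 j := fun j => by fun_prop
  have hw : Measurable fun x : Ω × (ℕ → ℝ) => σ x.1 + B.indicator (fun _ => x.2 0) x.1 := by
    refine (hσ.comp measurable_fst).add ?_
    have : (fun x : Ω × (ℕ → ℝ) => B.indicator (fun _ => x.2 0) x.1) =
        (Prod.fst ⁻¹' B).indicator (fun x : Ω × (ℕ → ℝ) => x.2 0) := by
      ext x; by_cases hx : x.1 ∈ B <;> simp [hx]
    rw [this]
    exact (hv 0).indicator (measurable_fst hB)
  unfold tailMap tailStep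
  refine Measurable.max (Measurable.sub ?_ (hτ.comp measurable_fst)) measurable_const
  split_ifs
  · exact ((hv i).max hw).min (hv _)
  · exact (hv i).max hw

variable {P : Measure Ω}

theorem integrable_tailState (hθ : MeasurePreserving θ P P) (hB : MeasurableSet B)
    (hσ : Measurable σ) (hτ : Measurable τ) (hσi : Integrable σ P) (hτi : Integrable τ P)
    (n i : ℕ) : Integrable (fun ω => tailState θ q B σ τ n ω i) P := by
  induction n generalizing i with
  | zero => exact integrable_zero _ _ _
  | succ n ih =>
    have hm := (measurable_pi_apply i).comp (measurable_tailState (θ := θ) (q := q) hB hσ hτ (n + 1))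
    refine (hθ.integrable_comp_emb θ.measurableEmbedding).1 ?_
    refine Integrable.mono' (((((ih i).add hσi.abs).add (ih 0))).add hτi.abs)
      (hm.comp θ.measurable).aestronglyMeasurable (Eventually.of_forall fun ω => ?_)
    have h0 := tailState_nonneg (θ := θ) (q := q) (B := B) (σ := σ) (τ := τ) n ω 0
    have hi := tailState_nonneg (θ := θ) (q := q) (B := B) (σ := σ) (τ := τ) n ω i
    simp only [Function.comp_apply, tailState_succ_apply, Pi.add_apply, Real.norm_eq_abs]
    rw [tailMap, abs_of_nonneg (tailStep_nonneg i), tailStep]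
    have hind : B.indicator (fun _ => tailState θ q B σ τ n ω 0) ω ≤ tailState θ q B σ τ n ω 0 :=
      Set.indicator_apply_le' (fun _ => le_rfl) fun _ => h0
    have habs := abs_nonneg (σ ω)
    have habt := abs_nonneg (τ ω)
    have hx : max (tailState θ q B σ τ n ω i)
        (σ ω + B.indicator (fun _ => tailState θ q B σ τ n ω 0) ω) ≤
        tailState θ q B σ τ n ω i + |σ ω| + tailState θ q B σ τ n ω 0 :=
      max_le (by linarith) (by linarith [le_abs_self (σ ω)])
    refine max_le ?_ (by linarith)
    have ht := neg_abs_le (τ ω)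
    split_ifs
    · linarith [min_le_left (max (tailState θ q B σ τ n ω i)
        (σ ω + B.indicator (fun _ => tailState θ q B σ τ n ω 0) ω))
        (tailState θ q B σ τ n ω (i + 1))]
    · linarith

/-- The drift inequality of the majorant. -/
theorem integral_drift_nonneg (hθ : MeasurePreserving θ P P) (hB : MeasurableSet B)
    (hσ : Measurable σ) (hτ : Measurable τ) (hσi : Integrable σ P) (hτi : Integrable τ P)
    (n : ℕ) {i : ℕ} (hi : i < q)
    (hint : Integrable (fun ω => max (σ ω + B.indicator (fun _ => tailState θ q B σ τ n ω 0) ω -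
      tailState θ q B σ τ n ω i) 0 -
      ∑ l ∈ Finset.Ico i q, min (tailState θ q B σ τ n ω l) (τ ω)) P) :
    0 ≤ ∫ ω, (max (σ ω + B.indicator (fun _ => tailState θ q B σ τ n ω 0) ω -
      tailState θ q B σ τ n ω i) 0 -
      ∑ l ∈ Finset.Ico i q, min (tailState θ q B σ τ n ω l) (τ ω)) ∂P := by
  have hI := integrable_tailState (q := q) hθ hB hσ hτ hσi hτi
  have hS : ∀ m, Integrable (fun ω => ∑ l ∈ Finset.Ico i q, tailState θ q B σ τ m ω l) P :=
    fun m => integrable_finsetSum _ fun l _ => hI m l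
  have h1 : ∫ ω, ∑ l ∈ Finset.Ico i q, tailState θ q B σ τ n ω l ∂P ≤
      ∫ ω, ∑ l ∈ Finset.Ico i q, tailState θ q B σ τ (n + 1) ω l ∂P :=
    integral_mono (hS n) (hS (n + 1)) fun ω => Finset.sum_le_sum fun l _ =>
      tailState_monotone ω l n.le_succ
  -- Invariance allows evaluation at `θ ω`, where state `n + 1` is one step from state `n`.
  rw [← hθ.integral_comp θ.measurableEmbedding
    (fun ω => ∑ l ∈ Finset.Ico i q, tailState θ q B σ τ (n + 1) ω l)] at h1
  have h2 := integral_mono (μ := P) (f := fun ω => ∑ l ∈ Finset.Ico i q,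
      tailState θ q B σ τ (n + 1) (θ ω) l)
    ((hθ.integrable_comp_emb θ.measurableEmbedding).2 (hS (n + 1))) ((hS n).add hint) fun ω => by
      have := sum_tailStep_le (w := σ ω + B.indicator (fun _ => tailState θ q B σ τ n ω 0) ω)
        (t := τ ω) (tailState_sorted (θ := θ) (B := B) (σ := σ) (τ := τ) n ω) hi
      simp only [tailState_succ_apply, Pi.add_apply, tailMap]
      linarith
  simp only [Pi.add_apply] at h2
  rw [integral_add (hS n) hint] at h2
  linarith

variable [IsProbabilityMeasure P]

/-- One step lowers a coordinate by at most `τ`, so unboundedness propagates along `θ`. -/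
theorem ae_bddAbove_or_ae_not (hθ : Ergodic θ P) (hB : MeasurableSet B)
    (hσ : Measurable σ) (hτ : Measurable τ) {i : ℕ} :
    (∀ᵐ ω ∂P, BddAbove (Set.range fun n => tailState θ q B σ τ n ω i)) ∨
    ∀ᵐ ω ∂P, ¬ BddAbove (Set.range fun n => tailState θ q B σ τ n ω i) := by
  set A := {ω | ¬ BddAbove (Set.range fun n => tailState θ q B σ τ n ω i)} with hA
  have hAm : MeasurableSet A := (measurableSet_bddAbove_range fun n =>
    (measurable_pi_apply i).comp (measurable_tailState hB hσ hτ n)).compl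
  have hsub : A ⊆ θ ⁻¹' A := by
    rintro ω hω ⟨C, hC⟩
    refine hω ⟨C + τ ω, ?_⟩
    rintro _ ⟨n, rfl⟩
    have h1 : tailState θ q B σ τ (n + 1) (θ ω) i ≤ C := hC ⟨n + 1, rfl⟩
    rw [tailState_succ_apply] at h1
    have h2 := sub_le_tailStep (w := σ ω + B.indicator (fun _ => tailState θ q B σ τ n ω 0) ω)
      (t := τ ω) (tailState_sorted (θ := θ) (q := q) (B := B) (σ := σ) (τ := τ) n ω i)
    rw [tailMap] at h1
    simp only
    linarith
  rcases hθ.ae_empty_or_univ_of_ae_le_preimage hAm.nullMeasurableSet hsub.eventuallyLE with h | h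
  · refine Or.inl ?_
    filter_upwards [eventuallyEq_empty.1 h] with ω hω
    simpa [hA] using hω
  · exact Or.inr (eventuallyEq_univ.1 h)

/-- If rank `i` diverges, so do all ranks from `i` to `q - 1`, and the increment bound `F n` tends
to `f`, whose mean is negative. For `i ≠ 0`, boundedness of rank `0` makes the incoming job
eventually smaller than rank `i`, so it contributes nothing. -/
theorem ae_bddAbove_tailState_aux (hθ : Ergodic θ P) (hB : MeasurableSet B)
    (hσ : Measurable σ) (hτ : Measurable τ) (hσ0 : ∀ᵐ ω ∂P, 0 ≤ σ ω) (hσi : Integrable σ P)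
    (hτi : Integrable τ P) (hτ0 : 0 < ∫ ω, τ ω ∂P)
    (hdrift : ∫ ω in B, σ ω ∂P < q * ∫ ω, τ ω ∂P) {i : ℕ} (hi : i < q)
    (h0 : i ≠ 0 → ∀ᵐ ω ∂P, BddAbove (Set.range fun n => tailState θ q B σ τ n ω 0)) :
    ∀ᵐ ω ∂P, BddAbove (Set.range fun n => tailState θ q B σ τ n ω i) := by
  refine (ae_bddAbove_or_ae_not hθ hB hσ hτ).resolve_right fun hunb => ?_
  set Y := tailState θ q B σ τ with hY
  set F : ℕ → Ω → ℝ := fun n ω => max (σ ω + B.indicator (fun _ => Y n ω 0) ω - Y n ω i) 0 -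
    ∑ l ∈ Finset.Ico i q, min (Y n ω l) (τ ω) with hF
  set f : Ω → ℝ := fun ω => (if i = 0 then B.indicator σ ω else 0) -
    ∑ l ∈ Finset.Ico i q, τ ω with hf
  set b : Ω → ℝ := fun ω => |σ ω| + ∑ l ∈ Finset.Ico i q, |τ ω| with hb
  have hbi : Integrable b P := hσi.abs.add (integrable_finsetSum _ fun _ _ => hτi.abs)
  have hYm : ∀ n l, Measurable fun ω => Y n ω l := fun n l =>
    (measurable_pi_apply l).comp (measurable_tailState hB hσ hτ n)
  have hFm : ∀ n, Measurable (F n) := fun n => by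
    refine Measurable.sub (((hσ.add ?_).sub (hYm n i)).max measurable_const)
      (Finset.measurable_fun_sum _ fun l _ => (hYm n l).min hτ)
    have : (fun ω => B.indicator (fun _ => Y n ω 0) ω) = B.indicator fun ω => Y n ω 0 := by
      ext ω; by_cases h : ω ∈ B <;> simp [h]
    rw [this]
    exact (hYm n 0).indicator hB
  have hFb : ∀ n ω, ‖F n ω‖ ≤ b ω := fun n ω => by
    refine (norm_sub_le _ _).trans (add_le_add ?_ ((norm_sum_le _ _).trans
      (Finset.sum_le_sum fun l _ => ?_)))
    · rw [Real.norm_eq_abs, abs_of_nonneg (le_max_right _ _)]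
      refine max_le ?_ (abs_nonneg _)
      have h1 : B.indicator (fun _ => Y n ω 0) ω ≤ Y n ω 0 :=
        Set.indicator_apply_le' (fun _ => le_rfl) fun _ => tailState_nonneg n ω 0
      -- The workload joined on `B` is absorbed by rank `i`, so the domination is uniform in `n`.
      have h2 : Y n ω 0 ≤ Y n ω i := tailState_sorted_of_le n ω (Nat.zero_le i) hi
      linarith [le_abs_self (σ ω)]
    · have h1 : 0 ≤ Y n ω l := tailState_nonneg n ω l
      rw [Real.norm_eq_abs, abs_le]
      exact ⟨le_min (by linarith [abs_nonneg (τ ω)]) (neg_abs_le _),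
        (min_le_right _ _).trans (le_abs_self _)⟩
  have hlim : ∀ᵐ ω ∂P, Tendsto (fun n => F n ω) atTop (𝓝 (f ω)) := by
    have h0' : ∀ᵐ ω ∂P, i ≠ 0 → BddAbove (Set.range fun n => Y n ω 0) := by
      by_cases h : i = 0
      · exact Eventually.of_forall fun ω h' => absurd h h'
      · filter_upwards [h0 h] with ω hω _ using hω
    filter_upwards [hunb, h0', hσ0] with ω hω hω0 hωσ
    have htop : ∀ l ∈ Finset.Ico i q, Tendsto (fun n => Y n ω l) atTop atTop := fun l hl =>
      tendsto_atTop_mono (fun n => tailState_sorted_of_le n ω (Finset.mem_Ico.1 hl).1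
        (Finset.mem_Ico.1 hl).2)
        (tendsto_atTop_atTop_of_monotone' (tailState_monotone ω i) hω)
    have hitop := htop i (Finset.mem_Ico.2 ⟨le_rfl, hi⟩)
    refine Tendsto.sub ?_ (tendsto_finsetSum _ fun l hl => ?_)
    · refine tendsto_const_nhds.congr' ?_
      by_cases hi0 : i = 0
      · subst hi0
        by_cases hωB : ω ∈ B
        · exact Eventually.of_forall fun n => by simp [hωB, hωσ]
        · filter_upwards [hitop.eventually_ge_atTop (σ ω)] with n hn
          simp [hωB, hn]
      · obtain ⟨C, hC⟩ := hω0 hi0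
        filter_upwards [hitop.eventually_ge_atTop (σ ω + C)] with n hn
        have h1 : B.indicator (fun _ => Y n ω 0) ω ≤ Y n ω 0 :=
          Set.indicator_apply_le' (fun _ => le_rfl) fun _ => tailState_nonneg n ω 0
        have h2 : Y n ω 0 ≤ C := hC ⟨n, rfl⟩
        rw [if_neg hi0, max_eq_right (by linarith)]
    · refine tendsto_const_nhds.congr' ?_
      filter_upwards [(htop l hl).eventually_ge_atTop (τ ω)] with n hn
      rw [min_eq_right hn]
  have hT := tendsto_integral_of_dominated_convergence b
    (fun n => (hFm n).aestronglyMeasurable) hbi (fun n => Eventually.of_forall (hFb n)) hlim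
  have hnn : 0 ≤ ∫ ω, f ω ∂P := ge_of_tendsto' hT fun n =>
    integral_drift_nonneg hθ.toMeasurePreserving hB hσ hτ hσi hτi n hi
      (hbi.mono' (hFm n).aestronglyMeasurable (Eventually.of_forall (hFb n)))
  have hsum : ∀ ω, ∑ l ∈ Finset.Ico i q, τ ω = ((q : ℝ) - i) * τ ω := fun ω => by
    rw [Finset.sum_const, Nat.card_Ico, nsmul_eq_mul, Nat.cast_sub hi.le]
  simp only [hf, hsum] at hnn
  have hiq : (i : ℝ) < q := by exact_mod_cast hi
  by_cases hi0 : i = 0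
  · subst hi0
    simp only [if_true] at hnn
    rw [integral_sub (hσi.indicator hB) (hτi.const_mul _), integral_const_mul,
      integral_indicator hB] at hnn
    simp at hnn
    linarith
  · simp only [if_neg hi0] at hnn
    rw [integral_sub (integrable_const _) (hτi.const_mul _), integral_const_mul] at hnn
    simp at hnn
    nlinarith [mul_pos (sub_pos.2 hiq) hτ0]

/-- The backward states of the majorant are almost surely bounded if the drift is negative. -/
theorem ae_bddAbove_tailState (hθ : Ergodic θ P) (hB : MeasurableSet B)
    (hσ : Measurable σ) (hτ : Measurable τ) (hσ0 : ∀ᵐ ω ∂P, 0 ≤ σ ω) (hσi : Integrable σ P)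
    (hτi : Integrable τ P) (hτ0 : 0 < ∫ ω, τ ω ∂P)
    (hdrift : ∫ ω in B, σ ω ∂P < q * ∫ ω, τ ω ∂P) {i : ℕ} (hi : i < q) :
    ∀ᵐ ω ∂P, BddAbove (Set.range fun n => tailState θ q B σ τ n ω i) :=
  ae_bddAbove_tailState_aux hθ hB hσ hτ hσ0 hσi hτi hτ0 hdrift hi fun _ =>
    ae_bddAbove_tailState_aux hθ hB hσ hτ hσ0 hσi hτi hτ0 hdrift (Nat.zero_lt_of_lt hi)
      fun h => absurd rfl h

end Stationary

/-! ### Iterates of the shift. -/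

section Shift

variable {Ω : Type*} [MeasurableSpace Ω] {θ : Ω ≃ᵐ Ω}

theorem shift_zero (ω : Ω) : shift θ 0 ω = ω := by simp [shift]

theorem shift_add_one (n : ℤ) (ω : Ω) : shift θ (n + 1) ω = shift θ n (θ ω) := by
  simp only [shift, zpow_add_one]
  rfl

theorem shift_sub_one (n : ℤ) (ω : Ω) : shift θ (n - 1) ω = shift θ n (θ.symm ω) := by
  simp only [shift, zpow_sub_one]
  rfl

theorem shift_neg_one (ω : Ω) : shift θ (-1) ω = θ.symm ω := by
  rw [← zero_sub, shift_sub_one, shift_zero]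

theorem measurePreserving_shift {P : Measure Ω} (hθ : MeasurePreserving θ P P) (n : ℤ) :
    MeasurePreserving (shift θ n) P P := by
  induction n with
  | zero =>
    have h : shift θ 0 = id := funext shift_zero
    rw [h]
    exact MeasurePreserving.id P
  | succ n ih =>
    have h : shift θ (n + 1) = shift θ n ∘ θ := funext (shift_add_one _)
    rw [h]
    exact ih.comp hθ
  | pred n ih =>
    have h : shift θ (-n - 1) = shift θ (-n) ∘ θ.symm := funext (shift_sub_one _)
    rw [h]
    exact ih.comp hθ.symm

end Shift

/-! ### The queue started empty, and its domination. -/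

section Queue

variable {Ω : Type*} [MeasurableSpace Ω] {θ : Ω ≃ᵐ Ω} {σ τ : Ω → ℝ} {S p : ℕ}

/-- The service profile at time `0`, started empty at time `-n`. -/
noncomputable def queueState (θ : Ω ≃ᵐ Ω) (σ τ : Ω → ℝ) (hp : p < S) (n : ℕ) (ω : Ω) :
    ServiceProfile S :=
  backwardState θ (fun ω => jswMap p hp (σ ω) (τ ω)) (emptyProfile S) n ω

theorem measurable_queueState (hσ : Measurable σ) (hτ : Measurable τ) (hp : p < S) (n : ℕ) :
    Measurable (queueState θ σ τ hp n) :=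
  measurable_backwardState ((measurable_jswMap hp).comp ((hσ.comp measurable_fst).prodMk
    ((hτ.comp measurable_fst).prodMk measurable_snd))) n

section Past

variable {Ω' : Type*} [MeasurableSpace Ω'] {φ : Ω' → Ω}

/-- The map `φ` leaves the σ-algebra of the source free: with `φ = id` and the σ-algebra generated
by past inputs, this yields measurability with respect to the past. -/
theorem measurable_residualSup_comp
    (hσ : ∀ k : ℕ, 1 ≤ k → Measurable fun x => σ (shift θ (-(k : ℤ)) (φ x)))
    (hτ : ∀ k : ℕ, 1 ≤ k → Measurable fun x => τ (shift θ (-(k : ℤ)) (φ x))) (hp : 1 ≤ p) :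
    Measurable fun x => residualSup θ σ τ p (φ x) := by
  unfold residualSup
  refine Measurable.max (Measurable.iSup fun k => Measurable.iSup fun hk => ?_) measurable_const
  refine Measurable.coe_real_ereal (Measurable.sub (hσ k (hp.trans hk)) ?_)
  exact Finset.measurable_fun_sum _ fun i hi => hτ i (Finset.mem_Icc.1 hi).1

theorem measurable_queueState_comp
    (hσ : ∀ k : ℕ, 1 ≤ k → Measurable fun x => σ (shift θ (-(k : ℤ)) (φ x)))
    (hτ : ∀ k : ℕ, 1 ≤ k → Measurable fun x => τ (shift θ (-(k : ℤ)) (φ x))) (hp : p < S)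
    (n j : ℕ) : Measurable fun x => queueState θ σ τ hp n (shift θ (-(j : ℤ)) (φ x)) := by
  induction n generalizing j with
  | zero => exact measurable_const
  | succ n ih =>
    have h : ∀ ω, θ.symm (shift θ (-(j : ℤ)) ω) = shift θ (-((j + 1 : ℕ) : ℤ)) ω := fun ω => by
      rw [← shift_neg_one]
      simp only [shift, ← Equiv.Perm.mul_apply, ← zpow_add]
      congr 2
      push_cast; ring
    have h2 : ∀ ω, queueState θ σ τ hp (n + 1) (shift θ (-(j : ℤ)) ω) =
        jswMap p hp (σ (shift θ (-((j + 1 : ℕ) : ℤ)) ω)) (τ (shift θ (-((j + 1 : ℕ) : ℤ)) ω))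
          (queueState θ σ τ hp n (shift θ (-((j + 1 : ℕ) : ℤ)) ω)) := fun ω => by
      rw [← h]; rfl
    simp only [h2]
    exact (measurable_jswMap hp).comp ((hσ _ (by omega)).prodMk ((hτ _ (by omega)).prodMk
      (ih (j + 1))))

theorem measurableSet_queueState_add_le
    (hσ : ∀ k : ℕ, Measurable fun x => σ (shift θ (-(k : ℤ)) (φ x)))
    (hτ : ∀ k : ℕ, 1 ≤ k → Measurable fun x => τ (shift θ (-(k : ℤ)) (φ x))) (hp : p < S)
    (M : ℝ) :
    MeasurableSet {x | ∀ n i, (queueState θ σ τ hp n (φ x)).1 i + σ (φ x) ≤ M} := by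
  simp only [Set.ofPred_forall]
  refine MeasurableSet.iInter fun n => MeasurableSet.iInter fun i =>
    measurableSet_le (Measurable.add ?_ ?_) measurable_const
  · have := measurable_queueState_comp (fun k _ => hσ k) hτ hp n 0
    simp only [Nat.cast_zero, neg_zero, shift_zero] at this
    exact (measurable_pi_apply i).comp (measurable_subtype_coe.comp this)
  · simpa [shift_zero] using hσ 0

end Past

/-- The inputs that are non-negative at all times. -/
def NonnegInput (θ : Ω ≃ᵐ Ω) (σ τ : Ω → ℝ) (ω : Ω) : Prop :=
  ∀ n : ℤ, 0 ≤ σ (shift θ n ω) ∧ 0 ≤ τ (shift θ n ω)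

theorem NonnegInput.symm_apply {ω : Ω} (h : NonnegInput θ σ τ ω) :
    NonnegInput θ σ τ (θ.symm ω) := fun n => by
  rw [← shift_sub_one]; exact h _

theorem NonnegInput.nonneg {ω : Ω} (h : NonnegInput θ σ τ ω) : 0 ≤ σ ω ∧ 0 ≤ τ ω := by
  simpa only [shift_zero] using h 0

theorem ae_nonnegInput {P : Measure Ω} (hθ : MeasurePreserving θ P P)
    (hσ : ∀ᵐ ω ∂P, 0 ≤ σ ω) (hτ : ∀ᵐ ω ∂P, 0 < τ ω) : ∀ᵐ ω ∂P, NonnegInput θ σ τ ω := by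
  refine ae_all_iff.2 fun n => ?_
  have h := (measurePreserving_shift hθ n).quasiMeasurePreserving
  filter_upwards [h.ae hσ, h.ae hτ] with ω h1 h2 using ⟨h1, h2.le⟩

theorem shift_neg_symm (k : ℕ) (ω : Ω) :
    shift θ (-(k : ℤ)) (θ.symm ω) = shift θ (-((k + 1 : ℕ) : ℤ)) ω := by
  rw [← shift_sub_one]; congr 1; push_cast; ring

/-- A server among the `p` least loaded that is busy has only been given, when it was free, some
customer who is still in service. -/
theorem exists_le_of_queueState_pos (hp : p < S) (n : ℕ) {ω : Ω} (hω : NonnegInput θ σ τ ω)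
    {l : ℕ} (hl : l < p) (hpos : 0 < (queueState θ σ τ hp n ω).1 ⟨l, hl.trans hp⟩) :
    ∃ k : ℕ, p ≤ k + l ∧ (queueState θ σ τ hp n ω).1 ⟨l, hl.trans hp⟩ ≤
      σ (shift θ (-(k : ℤ)) ω) - ∑ i ∈ Finset.Icc 1 k, τ (shift θ (-(i : ℤ)) ω) := by
  induction n generalizing ω l with
  | zero => exact absurd hpos (lt_irrefl _)
  | succ n ih =>
    set u := queueState θ σ τ hp n (θ.symm ω) with hu
    have hstep : queueState θ σ τ hp (n + 1) ω =
      jswMap p hp (σ (θ.symm ω)) (τ (θ.symm ω)) u := rfl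
    have hnn := hω.symm_apply.nonneg
    have hsum : ∀ k : ℕ, ∑ i ∈ Finset.Icc 1 (k + 1), τ (shift θ (-(i : ℤ)) ω) =
        τ (θ.symm ω) + ∑ i ∈ Finset.Icc 1 k, τ (shift θ (-(i : ℤ)) (θ.symm ω)) := fun k => by
      induction k with
      | zero => simp [shift_neg_one]
      | succ k ihk =>
        rw [Finset.sum_Icc_succ_top (by omega), ihk, Finset.sum_Icc_succ_top (by omega),
          shift_neg_symm, add_assoc]
    -- One arrival further back, `k` grows by one while the rank has dropped by at most one, so `p ≤
    -- k + l` persists.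
    have hrec : ∀ l' (hl' : l' < p), l' ≤ l + 1 →
        (queueState θ σ τ hp (n + 1) ω).1 ⟨l, hl.trans hp⟩ ≤
          u.1 ⟨l', hl'.trans hp⟩ - τ (θ.symm ω) →
        ∃ k : ℕ, p ≤ k + l ∧ (queueState θ σ τ hp (n + 1) ω).1 ⟨l, hl.trans hp⟩ ≤
          σ (shift θ (-(k : ℤ)) ω) - ∑ i ∈ Finset.Icc 1 k, τ (shift θ (-(i : ℤ)) ω) := by
      intro l' hl' hll h
      obtain ⟨k, hk, hle⟩ := ih hω.symm_apply hl' (by linarith)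
      refine ⟨k + 1, by omega, ?_⟩
      rw [hsum, ← shift_neg_symm]
      linarith
    by_cases h : l + 1 < p
    · refine hrec (l + 1) h le_rfl ?_
      have h1 := jswMap_le_next (s := σ (θ.symm ω)) (t := τ (θ.symm ω)) (u := u) hp
        ⟨l, hl.trans hp⟩ ⟨l + 1, h.trans hp⟩ rfl
      rw [← hstep] at h1
      exact (le_max_iff.1 h1).resolve_right (not_le.2 hpos)
    -- At rank `p - 1` the bound is either the old workload of that rank or the job of the last
    -- arrival, for which `k = 1`.
    · have h1 := jswMap_le_of_lt (s := σ (θ.symm ω)) (t := τ (θ.symm ω)) (u := u) hp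
        ⟨l, hl.trans hp⟩ hl
      rw [← hstep] at h1
      have h2 := (le_max_iff.1 h1).resolve_right (not_le.2 hpos)
      rcases max_cases (u.1 ⟨l, hl.trans hp⟩) (σ (θ.symm ω)) with ⟨h3, -⟩ | ⟨h3, -⟩
      · rw [h3] at h2
        exact hrec l hl (Nat.le_succ l) h2
      · rw [h3] at h2
        refine ⟨0 + 1, by omega, ?_⟩
        rw [hsum, ← shift_neg_symm]
        simpa [shift_zero] using h2

/-- At rank `0` the constraint becomes `p ≤ k`, the range defining `Z_p`. The absence of a free
server is thus confined to an event independent of the starting time. -/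
theorem residualSup_pos_of_queueState_pos (hp1 : 1 ≤ p) (hp : p < S) (n : ℕ) {ω : Ω}
    (hω : NonnegInput θ σ τ ω)
    (hpos : 0 < (queueState θ σ τ hp n ω).1 ⟨0, Nat.zero_lt_of_lt hp⟩) :
    0 < residualSup θ σ τ p ω := by
  obtain ⟨k, hk, hle⟩ := exists_le_of_queueState_pos hp n hω (l := 0) hp1 hpos
  refine lt_max_of_lt_left (lt_of_lt_of_le ?_ (le_iSup₂_of_le k (by omega) le_rfl))
  exact_mod_cast hpos.trans_le hle

/-- The majorant dominates the workloads of rank larger than `p`. -/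
theorem queueState_le_tailState (hp1 : 1 ≤ p) (hp : p < S) (n : ℕ) {ω : Ω}
    (hω : NonnegInput θ σ τ ω) (i : ℕ) (hi : p + i < S) :
    (queueState θ σ τ hp n ω).1 ⟨p + i, hi⟩ ≤
      tailState θ (S - p) {ω | 0 < residualSup θ σ τ p ω} σ τ n ω i := by
  induction n generalizing ω i with
  | zero => exact le_rfl
  | succ n ih =>
    set B := {ω | 0 < residualSup θ σ τ p ω} with hB
    set u := queueState θ σ τ hp n (θ.symm ω) with hu
    set v := tailState θ (S - p) B σ τ n (θ.symm ω) with hv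
    have huv : ∀ i (hi : p + i < S), u.1 ⟨p + i, hi⟩ ≤ v i := fun i hi => ih hω.symm_apply i hi
    change (jswMap p hp (σ (θ.symm ω)) (τ (θ.symm ω)) u).1 ⟨p + i, hi⟩ ≤
      tailStep (S - p) (σ (θ.symm ω) + B.indicator (fun _ => v 0) (θ.symm ω)) (τ (θ.symm ω)) v i
    have hmax : (jswMap p hp (σ (θ.symm ω)) (τ (θ.symm ω)) u).1 ⟨p + i, hi⟩ ≤
        max (max (v i) (σ (θ.symm ω) + B.indicator (fun _ => v 0) (θ.symm ω)) - τ (θ.symm ω))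
          0 := by
      by_cases h0 : u.1 ⟨0, Nat.zero_lt_of_lt hp⟩ = 0
      · refine (jswMap_le_max_of_free hp _ h0).trans (max_le_max (sub_le_sub_right
          (max_le_max (huv i hi) ?_) _) le_rfl)
        exact le_add_of_nonneg_right (Set.indicator_nonneg
          (fun _ _ => tailState_nonneg n (θ.symm ω) 0) _)
      -- Without a free server the job joins rank `p`, which is dominated by coordinate `0` of the
      -- majorant.
      · have hmem : θ.symm ω ∈ B := residualSup_pos_of_queueState_pos hp1 hp n hω.symm_apply
          (lt_of_le_of_ne (u.2.2 _) (Ne.symm h0))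
        refine (jswMap_le_max hp _).trans (max_le_max (sub_le_sub_right
          (max_le_max (huv i hi) ?_) _) le_rfl)
        rw [Set.indicator_of_mem hmem, add_comm]
        exact add_le_add le_rfl (huv 0 hp)
    unfold tailStep
    split_ifs with h
    · have hnext := (jswMap_le_next (s := σ (θ.symm ω)) (t := τ (θ.symm ω)) (u := u) hp
        ⟨p + i, hi⟩ ⟨p + (i + 1), by omega⟩ rfl).trans (max_le_max (sub_le_sub_right
          (huv (i + 1) (by omega)) _) le_rfl)
      rw [← min_sub_sub_right, max_min_distrib_right]
      exact le_min hmax hnext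
    · exact hmax

end Queue

/-! ### Bounded workloads, simultaneous emptying and the solution. -/

section Main

variable {Ω : Type*} [mΩ : MeasurableSpace Ω] {P : Measure Ω} [IsProbabilityMeasure P]
  {θ : Ω ≃ᵐ Ω} {σ τ : Ω → ℝ} {S p : ℕ}

/-- The service time of a customer is independent of the past of the input. -/
theorem IsGIGI.setIntegral_residualSup_pos (h : IsGIGI P θ σ τ)
    (hθ : MeasurePreserving θ P P) (hσ : Measurable σ) (hτ : Measurable τ) (hp : 1 ≤ p) :
    ∫ ω in {ω | 0 < residualSup θ σ τ p ω}, σ ω ∂P =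
      (∫ ω, σ ω ∂P) * P.real {ω | 0 < residualSup θ σ τ p ω} := by
  have hsm : ∀ n : ℤ, Measurable fun ω => σ (shift θ n ω) := fun n =>
    hσ.comp (measurePreserving_shift hθ n).measurable
  have htm : ∀ n : ℤ, Measurable fun ω => τ (shift θ n ω) := fun n =>
    hτ.comp (measurePreserving_shift hθ n).measurable
  have hind := IndepFun.indepFun_prodMk_restrict (measurable_pi_lambda _ htm) hsm h.indep_service
    h.indep_sequences.symm {n : ℤ | n < 0} (i := 0) (by simp)
  simp only [shift_zero] at hind
  set G : Ω → (ℤ → ℝ) × ({n : ℤ | n < 0} → ℝ) := fun ω =>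
    (fun n => τ (shift θ n ω), fun n => σ (shift θ n ω)) with hG
  have hGm : Measurable G := (measurable_pi_lambda _ htm).prodMk
    (measurable_pi_lambda _ fun n => hsm n)
  refine hind.setIntegral_eq hGm hσ ?_
  refine @measurable_residualSup_comp Ω mΩ θ σ τ p Ω (MeasurableSpace.comap G inferInstance) id
    (fun k hk => ?_) (fun k hk => ?_) hp _ measurableSet_Ioi
  · exact ((measurable_pi_apply (⟨-(k : ℤ), by simp; omega⟩ : {n : ℤ | n < 0})).comp
      measurable_snd).comp (comap_measurable G)
  · exact ((measurable_pi_apply (-(k : ℤ))).comp measurable_fst).comp (comap_measurable G)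

/-- The time until the next arrival is independent of the present customer and of the past. -/
theorem IsGIGI.measure_inter_lt (h : IsGIGI P θ σ τ)
    (hθ : MeasurePreserving θ P P) (hσ : Measurable σ) (hτ : Measurable τ) (hp : p < S) (M : ℝ) :
    P ({ω | ∀ n i, (queueState θ σ τ hp n ω).1 i + σ ω ≤ M} ∩ {ω | M < τ ω}) =
      P {ω | ∀ n i, (queueState θ σ τ hp n ω).1 i + σ ω ≤ M} * P {ω | M < τ ω} := by
  have hsm : ∀ n : ℤ, Measurable fun ω => σ (shift θ n ω) := fun n =>
    hσ.comp (measurePreserving_shift hθ n).measurable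
  have htm : ∀ n : ℤ, Measurable fun ω => τ (shift θ n ω) := fun n =>
    hτ.comp (measurePreserving_shift hθ n).measurable
  -- The event involves the present service time but only strictly past inter-arrival times.
  have hind := IndepFun.indepFun_prodMk_restrict (measurable_pi_lambda _ hsm) htm
    h.indep_interarrival h.indep_sequences {n : ℤ | n < 0} (i := 0) (by simp)
  simp only [shift_zero] at hind
  set G : Ω → (ℤ → ℝ) × ({n : ℤ | n < 0} → ℝ) := fun ω =>
    (fun n => σ (shift θ n ω), fun n => τ (shift θ n ω)) with hG
  refine hind.measure_inter_eq ?_ (measurableSet_Ioi (a := M))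
  refine @measurableSet_queueState_add_le Ω mΩ θ σ τ S p Ω
    (MeasurableSpace.comap G inferInstance) id (fun k => ?_) (fun k hk => ?_) hp M
  · exact ((measurable_pi_apply (-(k : ℤ))).comp measurable_fst).comp (comap_measurable G)
  · exact ((measurable_pi_apply (⟨-(k : ℤ), by simp; omega⟩ : {n : ℤ | n < 0})).comp
      measurable_snd).comp (comap_measurable G)

/-- The workloads of the systems started empty at any past time are almost surely bounded. -/
theorem ae_exists_queueState_le (hθ : Ergodic θ P) (hσ : Measurable σ) (hτ : Measurable τ)
    (hσ0 : ∀ᵐ ω ∂P, 0 ≤ σ ω) (hτ0 : ∀ᵐ ω ∂P, 0 < τ ω) (hσi : Integrable σ P)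
    (hτi : Integrable τ P) (h : IsGIGI P θ σ τ) (hp1 : 1 ≤ p) (hp : p < S)
    (hdrift : (∫ ω, σ ω ∂P) * P.real {ω | 0 < residualSup θ σ τ p ω} <
      ((S : ℝ) - p) * ∫ ω, τ ω ∂P) :
    ∀ᵐ ω ∂P, ∃ C : ℝ, ∀ n i, (queueState θ σ τ hp n ω).1 i ≤ C := by
  have hB : MeasurableSet {ω | 0 < residualSup θ σ τ p ω} := by
    refine measurable_residualSup_comp (φ := id) (fun k _ => ?_) (fun k _ => ?_) hp1
      measurableSet_Ioi
    · exact hσ.comp (measurePreserving_shift hθ.toMeasurePreserving _).measurable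
    · exact hτ.comp (measurePreserving_shift hθ.toMeasurePreserving _).measurable
  have hτpos : 0 < ∫ ω, τ ω ∂P := by
    refine (integral_pos_iff_support_of_nonneg_ae (hτ0.mono fun ω hω => hω.le) hτi).2 ?_
    have : Function.support τ =ᵐ[P] Set.univ :=
      eventuallyEq_univ.2 (hτ0.mono fun ω hω => hω.ne')
    rw [measure_congr this, measure_univ]
    exact one_pos
  rw [← h.setIntegral_residualSup_pos hθ.toMeasurePreserving hσ hτ hp1, ← Nat.cast_sub hp.le]
    at hdrift
  -- The top rank of the majorant bounds the largest workload, hence all of them.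
  have hbdd := ae_bddAbove_tailState hθ hB hσ hτ hσ0 hσi hτi hτpos hdrift
    (i := S - p - 1) (by omega)
  filter_upwards [hbdd, ae_nonnegInput hθ.toMeasurePreserving hσ0 hτ0] with ω ⟨C, hC⟩ hω
  refine ⟨C, fun n i => ?_⟩
  have hi : i ≤ ⟨p + (S - p - 1), by omega⟩ := Fin.le_def.2 (by simp; omega)
  exact ((queueState θ σ τ hp n ω).2.1 hi).trans
    ((queueState_le_tailState hp1 hp n hω _ _).trans (hC ⟨n, rfl⟩))

/-- With positive probability, all the systems started empty in the past are empty. -/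
theorem measure_forall_queueState_eq_empty_pos (hθ : Ergodic θ P) (hσ : Measurable σ)
    (hτ : Measurable τ)
    (hσ0 : ∀ᵐ ω ∂P, 0 ≤ σ ω) (h : IsGIGI P θ σ τ) (hp : p < S)
    (hτ_unbdd : ∀ M : ℝ, 0 < P {ω | M < τ ω})
    (hbdd : ∀ᵐ ω ∂P, ∃ C : ℝ, ∀ n i, (queueState θ σ τ hp n ω).1 i ≤ C) :
    0 < P {ω | ∀ n, queueState θ σ τ hp n ω = emptyProfile S} := by
  obtain ⟨M, hM⟩ : ∃ M : ℕ, 0 < P {ω | ∀ n i, (queueState θ σ τ hp n ω).1 i + σ ω ≤ (M : ℝ)} := by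
    by_contra! hcon
    have h1 : P (⋃ M : ℕ, {ω | ∀ n i, (queueState θ σ τ hp n ω).1 i + σ ω ≤ (M : ℝ)}) = 0 :=
      measure_iUnion_null fun M => le_antisymm (hcon M) bot_le
    have h2 : (⋃ M : ℕ, {ω | ∀ n i, (queueState θ σ τ hp n ω).1 i + σ ω ≤ (M : ℝ)}) =ᵐ[P]
        Set.univ := by
      refine eventuallyEq_univ.2 (hbdd.mono fun ω ⟨C, hC⟩ => ?_)
      obtain ⟨M, hM⟩ := exists_nat_ge (C + σ ω)
      exact Set.mem_iUnion.2 ⟨M, fun n i => by linarith [hC n i]⟩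
    rw [measure_congr h2, measure_univ] at h1
    exact one_ne_zero h1
  have hpos := ENNReal.mul_pos hM.ne' (hτ_unbdd M).ne'
  rw [← h.measure_inter_lt hθ.toMeasurePreserving hσ hτ hp] at hpos
  -- The long gap follows the arrival at time `0`, so the systems are empty one step later, at `θ
  -- ω`.
  rw [← hθ.toMeasurePreserving.measure_preimage_equiv]
  refine hpos.trans_le (measure_mono_ae ?_)
  filter_upwards [hσ0] with ω hω0 hω n
  cases n with
  | zero => rfl
  | succ n =>
    refine (backwardState_succ_apply n ω).trans ?_
    exact jswMap_eq_empty hp hω0 fun i => (hω.1 n i).trans hω.2.le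

end Main

theorem theorem1 {Ω : Type*} [MeasurableSpace Ω] (P : Measure Ω) [IsProbabilityMeasure P]
    (θ : Ω ≃ᵐ Ω) (hθ : Ergodic θ P)
    (σ τ : Ω → ℝ) (hσ_meas : Measurable σ) (hτ_meas : Measurable τ)
    (hσ_nonneg : ∀ᵐ ω ∂P, 0 ≤ σ ω) (hτ_pos : ∀ᵐ ω ∂P, 0 < τ ω)
    (hσ_int : Integrable σ P) (hτ_int : Integrable τ P)
    (hGIGI : IsGIGI P θ σ τ)
    (hτ_unbdd : ∀ M : ℝ, 0 < P {ω | M < τ ω})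
    (S p : ℕ) (hp1 : 1 ≤ p) (hpS : p < S)
    (hZ_pos : (∫ ω, σ ω ∂P) * P.real {ω | 0 < residualSup θ σ τ p ω} < ((S : ℝ) - p) * ∫ ω, τ ω ∂P)
    (hZ_zero : 0 < P {ω | residualSup θ σ τ p ω = 0}) :
    ∃ W : Ω → ServiceProfile S, Measurable W ∧
      ∀ᵐ ω ∂P, W (θ ω) = jswMap p hpS (σ ω) (τ ω) (W ω) := by
  have hbdd := ae_exists_queueState_le hθ hσ_meas hτ_meas hσ_nonneg hτ_pos hσ_int hτ_int hGIGI
    hp1 hpS hZ_pos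
  have hXm : ∀ n, Measurable (queueState θ σ τ hpS n) :=
    measurable_queueState hσ_meas hτ_meas hpS
  have hDm : MeasurableSet {ω | ∀ n, queueState θ σ τ hpS n ω = emptyProfile S} := by
    simp only [Set.ofPred_forall]
    exact MeasurableSet.iInter fun n => hXm n (measurableSet_singleton _)
  have hcoupl : ∀ᵐ ω ∂P, ∃ c, ∀ᶠ n in atTop, queueState θ σ τ hpS n ω = c := by
    filter_upwards [hθ.ae_exists_iterate_symm_mem hDm (measure_forall_queueState_eq_empty_pos hθ
      hσ_meas hτ_meas hσ_nonneg hGIGI hpS hτ_unbdd hbdd)] with ω ⟨k, hk⟩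
    refine ⟨queueState θ σ τ hpS k ω, eventually_atTop.2 ⟨k, fun n hn => ?_⟩⟩
    obtain ⟨m, rfl⟩ := Nat.exists_eq_add_of_le' hn
    exact eventuallyConst_backwardState k hk m
  obtain ⟨W, hWm, hW⟩ := measurable_limit_of_tendsto_metrizable_ae (L := atTop)
    (fun n => (hXm n).aemeasurable)
    (hcoupl.mono fun ω ⟨c, hc⟩ => ⟨c, tendsto_const_nhds.congr' (hc.mono fun n hn => hn.symm)⟩)
  refine ⟨W, hWm, ?_⟩
  filter_upwards [hcoupl, hW, hθ.toMeasurePreserving.quasiMeasurePreserving.ae hW]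
    with ω ⟨c, hc⟩ h1 h2
  have hc' : W ω = c :=
    tendsto_nhds_unique h1 (tendsto_const_nhds.congr' (hc.mono fun n hn => hn.symm))
  -- The states are eventually equal to `W ω`, so no continuity of `G^p` is needed to pass to the
  -- limit.
  refine tendsto_nhds_unique (h2.comp (tendsto_add_atTop_nat 1))
    (tendsto_const_nhds.congr' (hc.mono fun n hn => ?_))
  rw [hc', ← hn]
  exact (backwardState_succ_apply n ω).symm
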